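/- Let $r\ge 2$. An $r$-graph is a finite hypergraph $G$ without repeated edges in which every edge is a set of exactly $r$ vertices; it is linear if any two distinct edges share at most one vertex, and $e(G)$ denotes its number of edges. For $m\ge 3$ the $r$-uniform linear cycle $C^{(r)}_m$ is the $r$-graph obtained from the $2$-uniform cycle $v_1v_2\cdots v_mv_1$ on $m$ distinct vertices by extending each edge $v_iv_{i+1}$ (indices modulo $m$) by a set $I_i$ of $r-2$ new vertices, where $I_1,\dots,I_m$ are pairwise disjoint. A copy of $C^{(r)}_m$ in $G$ is a subhypergraph of $G$ isomorphic to $C^{(r)}_m$. Theorem. For all integers $k,r\ge 2$ there are constants $C,c>0$, depending only on $k$ and $r$, such that for every $n\ge 1$, every $n$-vertex linear $r$-graph $G$ with $e(G)\ge C n^{1+1/k}$ contains at least $c\left(\frac{e(G)}{n}\right)^{2k}$ copies of $C^{(r)}_{2k}$. -/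

import Mathlib

open scoped Hypergraph

namespace Hypergraph

/-- `G` is an `r`-graph: every edge has exactly `r` vertices. -/
def IsUniform {α : Type*} (G : Hypergraph α) (r : ℕ) : Prop :=
  ∀ e ∈ E(G), e.encard = r

/-- `G` is linear: any two distinct edges share at most one vertex. -/
def IsLinear {α : Type*} (G : Hypergraph α) : Prop :=
  ∀ e ∈ E(G), ∀ f ∈ E(G), e ≠ f → (e ∩ f).Subsingleton

/-- The copies of `H` in `G`: the subhypergraphs `K` of `G` that are isomorphic to `H`, i.e. that
are the image of `H` under a map that is injective on the vertices of `H`. -/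
def copies {α β : Type*} (H : Hypergraph β) (G : Hypergraph α) : Set (Hypergraph α) :=
  {K | V(K) ⊆ V(G) ∧ E(K) ⊆ E(G) ∧ ∃ f : β → α, Set.InjOn f V(H) ∧ K = H.image f}

/-- The number of copies of `H` in `G` (unlabelled; `copies H G` is finite if `V(G)` is). -/
noncomputable def numCopies {α β : Type*} (H : Hypergraph β) (G : Hypergraph α) : ℕ :=
  (copies H G).ncard

/-- The successor of `i` modulo `m`. -/
def cyclicSucc {m : ℕ} (i : Fin m) : Fin m :=
  ⟨((i : ℕ) + 1) % m, Nat.mod_lt _ i.pos⟩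

/-- The `r`-uniform linear cycle of length `m` (for `m ≥ 3`, `r ≥ 2`): the vertices of the underlying
2-uniform cycle are `Sum.inl i`, and the pair `i, i + 1` (modulo `m`) is extended by the `r - 2` new
vertices `Sum.inr (i, j)`, which are distinct for distinct `i`. -/
def linearCycle (r m : ℕ) : Hypergraph (Fin m ⊕ Fin m × Fin (r - 2)) where
  vertexSet := Set.univ
  edgeSet := Set.range fun i : Fin m =>
    {Sum.inl i, Sum.inl (cyclicSucc i)} ∪ Set.range fun j : Fin (r - 2) => Sum.inr (i, j)
  subset_vertexSet_of_mem_edgeSet' := fun _ _ => Set.subset_univ _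

end Hypergraph

open Finset

/-! Put k = m + 1 and δ = e(G)/n. Passing to an induced subhypergraph of minimum degree at least δ,
join two vertices when they share an edge. Linearity makes the degrees of this graph at least δ, but
they may be very irregular, so closed walks of length 2k are weighted by the normalized adjacency
matrix M = D^{-1/2} A D^{-1/2} instead of being counted.

Let h_j = tr M^{2j}. The vector of square roots of degrees is fixed by M, so h_j ≥ 1
(`one_le_sqSum_normAdjMatrix`). A closed walk is bad if somewhere, in one of the two directions, a
point conflicts with the k steps that follow its neighbour on the walk. Once these k steps are
fixed, at most s = O(k r²) points conflict with them. Cauchy–Schwarz then bounds the bad weight at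
one position by √((s/δ) h_k h_{k-1}) (`sq_sum_closedWeight_conflict_le`). Log-convexity of h_j with
h_0 = n, together with C^k n ≤ δ^k, gives h_{k-1} ≤ (δ/C) h_k. For C large the bad walks therefore
carry at most half of h_k.

The remaining weight is at least 1/2, and each walk weighs at most δ^{-2k}, so at least δ^{2k}/2
walks are conflict-free. Each of them traces a linear cycle (`exists_isLinearCycle`), and a copy
arises from boundedly many walks. -/

theorem Finset.sum_le_sum_of_injOn_of_nonneg {ι κ : Type*} {s : Finset ι} {t : Finset κ}
    {f : ι → ℝ} {g : κ → ℝ} (φ : ι → κ) (hst : ∀ i ∈ s, φ i ∈ t) (hφ : Set.InjOn φ s)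
    (hfg : ∀ i ∈ s, f i = g (φ i)) (hg : ∀ j ∈ t, 0 ≤ g j) : ∑ i ∈ s, f i ≤ ∑ j ∈ t, g j := by
  classical
  rw [Finset.sum_congr rfl hfg, ← Finset.sum_image hφ]
  exact Finset.sum_le_sum_of_subset_of_nonneg (Finset.image_subset_iff.mpr hst)
    fun j hj _ => hg j hj

/-! ### Weighted walks and traces of powers of a symmetric matrix. -/

namespace Matrix

section

variable {V : Type*}

/-- The product of the entries of `M` along the steps of the path `p`. -/
def pathWeight (M : Matrix V V ℝ) {n : ℕ} (p : Fin (n + 1) → V) : ℝ :=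
  ∏ i : Fin n, M (p i.castSucc) (p i.succ)

/-- The product of the entries of `M` along the steps of the closed walk `x`. -/
def closedWeight (M : Matrix V V ℝ) {N : ℕ} [NeZero N] (x : ZMod N → V) : ℝ :=
  ∏ i, M (x i) (x (i + 1))

theorem pathWeight_nonneg {M : Matrix V V ℝ} (hM : ∀ a b, 0 ≤ M a b) {n : ℕ}
    (p : Fin (n + 1) → V) : 0 ≤ M.pathWeight p :=
  Finset.prod_nonneg fun _ _ => hM _ _

theorem closedWeight_nonneg {M : Matrix V V ℝ} (hM : ∀ a b, 0 ≤ M a b) {N : ℕ} [NeZero N]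
    (x : ZMod N → V) : 0 ≤ M.closedWeight x :=
  Finset.prod_nonneg fun _ _ => hM _ _

theorem pathWeight_natCast (M : Matrix V V ℝ) (f : ℕ → V) (n : ℕ) :
    M.pathWeight (fun i : Fin (n + 1) => f i) = ∏ i ∈ range n, M (f i) (f (i + 1)) := by
  simp [pathWeight, Finset.prod_range]

theorem closedWeight_eq_prod_range (M : Matrix V V ℝ) {N : ℕ} [NeZero N] (x : ZMod N → V) :
    M.closedWeight x = ∏ i ∈ range N, M (x i) (x (i + 1)) := by
  refine (Finset.prod_bij (M := ℝ) (s := range N) (fun i _ => (i : ZMod N))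
    (fun _ _ => Finset.mem_univ _) ?_ ?_ (fun _ _ => rfl)).symm
  · intro i hi j hj h
    have := congrArg ZMod.val h
    rwa [ZMod.val_cast_of_lt (by simpa using hi), ZMod.val_cast_of_lt (by simpa using hj)] at this
  · intro b _
    exact ⟨b.val, by simpa using ZMod.val_lt b, by simp⟩

theorem closedWeight_comp_add (M : Matrix V V ℝ) {N : ℕ} [NeZero N] (x : ZMod N → V) (i : ZMod N) :
    M.closedWeight (fun j => x (i + j)) = M.closedWeight x := by
  simp only [Matrix.closedWeight, ← add_assoc]
  exact Equiv.prod_comp (Equiv.addLeft i) (fun j => M (x j) (x (j + 1)))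

theorem closedWeight_comp_sub {M : Matrix V V ℝ} (hs : M.IsSymm) {N : ℕ} [NeZero N]
    (x : ZMod N → V) (i : ZMod N) : M.closedWeight (fun j => x (i - j)) = M.closedWeight x := by
  simp only [Matrix.closedWeight]
  rw [← Equiv.prod_comp (Equiv.subLeft (i - 1)) (fun j => M (x j) (x (j + 1)))]
  refine Finset.prod_congr rfl fun j _ => ?_
  rw [hs.apply]
  simp only [Equiv.subLeft_apply]
  congr 2 <;> ring

end

variable {V : Type*} [Fintype V] [DecidableEq V]

/-- The sum of the squares of the entries of `M ^ j`. -/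
def sqSum (M : Matrix V V ℝ) (j : ℕ) : ℝ := ∑ a, ∑ b, ((M ^ j) a b) ^ 2

theorem sum_pathWeight (M : Matrix V V ℝ) (n : ℕ) (a b : V) :
    ∑ p : Fin (n + 1) → V, (if p 0 = a ∧ p (Fin.last n) = b then M.pathWeight p else 0)
      = (M ^ n) a b := by
  induction n generalizing a with
  | zero =>
    rw [← Equiv.sum_comp (Equiv.funUnique (Fin 1) V).symm]
    simp only [pathWeight, pow_zero, Matrix.one_apply]
    simp [Fin.last, Finset.filter_and, Finset.filter_eq']
    split_ifs <;> simp_all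
  | succ n ih =>
    rw [← Equiv.sum_comp (Fin.consEquiv (fun _ : Fin (n + 2) => V)), Fintype.sum_prod_type,
      Finset.sum_eq_single a]
    · rw [pow_succ', Matrix.mul_apply]
      simp_rw [← ih, Finset.mul_sum]
      rw [Finset.sum_comm]
      refine Finset.sum_congr rfl fun p _ => ?_
      rw [Finset.sum_eq_single (p 0)]
      · simp [pathWeight, Fin.prod_univ_succ, ← Fin.succ_last, Fin.consEquiv]
      · intro c _ hc
        simp [hc.symm]
      · simp
    · intro c _ hc
      simp [Fin.consEquiv, hc]
    · simp

theorem pow_apply_comm {M : Matrix V V ℝ} (hs : M.IsSymm) (j : ℕ) (a b : V) :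
    (M ^ j) a b = (M ^ j) b a := (hs.pow j).apply b a

theorem sum_pow_mul_pow {M : Matrix V V ℝ} (hs : M.IsSymm) (i j : ℕ) :
    ∑ a, ∑ b, (M ^ i) a b * (M ^ j) a b = (M ^ (i + j)).trace := by
  rw [pow_add]
  simp only [Matrix.trace, Matrix.diag, Matrix.mul_apply]
  exact Finset.sum_congr rfl fun a _ => Finset.sum_congr rfl fun b _ => by
    rw [pow_apply_comm hs j a b]

theorem sqSum_eq_trace {M : Matrix V V ℝ} (hs : M.IsSymm) (j : ℕ) :
    M.sqSum j = (M ^ (2 * j)).trace := by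
  rw [two_mul, ← sum_pow_mul_pow hs]
  simp [sqSum, sq]

theorem sqSum_nonneg (M : Matrix V V ℝ) (j : ℕ) : 0 ≤ M.sqSum j :=
  Finset.sum_nonneg fun _ _ => Finset.sum_nonneg fun _ _ => sq_nonneg _

theorem sqSum_zero (M : Matrix V V ℝ) : M.sqSum 0 = Fintype.card V := by
  simp [sqSum, Matrix.one_apply]

/-- Cauchy–Schwarz for the entrywise product of `M ^ j` and `M ^ (j + 2)`, whose sum is the trace of
`M ^ (2 * (j + 1))`. -/
theorem sqSum_succ_sq_le {M : Matrix V V ℝ} (hs : M.IsSymm) (j : ℕ) :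
    M.sqSum (j + 1) ^ 2 ≤ M.sqSum j * M.sqSum (j + 2) := by
  rw [sqSum_eq_trace hs (j + 1), show 2 * (j + 1) = j + (j + 2) by ring, ← sum_pow_mul_pow hs]
  simp only [sqSum, ← Fintype.sum_prod_type']
  exact Finset.sum_mul_sq_le_sq_mul_sq _ _ _

/-- Log-convexity, iterated from the value `Fintype.card V` at 0. The induction step cancels a power
of the middle term, so the case where that term vanishes is separate. -/
theorem sqSum_pow_le {M : Matrix V V ℝ} (hs : M.IsSymm) (j : ℕ) :
    M.sqSum j ^ (j + 1) ≤ Fintype.card V * M.sqSum (j + 1) ^ j := by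
  induction j with
  | zero => simp [sqSum_zero]
  | succ j ih =>
    have h0 := M.sqSum_nonneg
    rcases (h0 (j + 1)).eq_or_lt with h | h
    · rw [← h, zero_pow (by lia)]
      exact mul_nonneg (Nat.cast_nonneg _) (pow_nonneg (h0 _) _)
    · have h1 : M.sqSum (j + 1) ^ j * M.sqSum (j + 1) ^ (j + 1 + 1) ≤
          M.sqSum (j + 1) ^ j * (Fintype.card V * M.sqSum (j + 1 + 1) ^ (j + 1)) := by
        calc _ = (M.sqSum (j + 1) ^ 2) ^ (j + 1) := by ring
          _ ≤ (M.sqSum j * M.sqSum (j + 2)) ^ (j + 1) :=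
            pow_le_pow_left₀ (sq_nonneg _) (sqSum_succ_sq_le hs j) _
          _ = M.sqSum j ^ (j + 1) * M.sqSum (j + 2) ^ (j + 1) := mul_pow _ _ _
          _ ≤ Fintype.card V * M.sqSum (j + 1) ^ j * M.sqSum (j + 2) ^ (j + 1) :=
            mul_le_mul_of_nonneg_right ih (pow_nonneg (h0 _) _)
          _ = _ := by ring
      exact le_of_mul_le_mul_left h1 (pow_pos h _)

theorem trace_pow_le_sum_closedWeight {M : Matrix V V ℝ} (hM : ∀ a b, 0 ≤ M a b) (N : ℕ)
    [NeZero N] : (M ^ N).trace ≤ ∑ x : ZMod N → V, M.closedWeight x := by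
  have h : (M ^ N).trace =
      ∑ p : Fin (N + 1) → V with p 0 = p (Fin.last N), M.pathWeight p := by
    simp only [Matrix.trace, Matrix.diag, ← sum_pathWeight]
    rw [Finset.sum_comm, Finset.sum_filter]
    refine Finset.sum_congr rfl fun p _ => ?_
    rw [Finset.sum_eq_single (p 0)] <;> simp +contextual [eq_comm]
  rw [h]
  let φ : (Fin (N + 1) → V) → ZMod N → V := fun p i => p ⟨i.val, (ZMod.val_lt i).trans (by lia)⟩
  have key : ∀ p : Fin (N + 1) → V, p 0 = p (Fin.last N) → ∀ i : Fin (N + 1),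
      φ p (i : ℕ) = p i := by
    intro p hp i
    rcases (Nat.lt_succ_iff.mp i.2).lt_or_eq with hi | hi
    · simp only [φ, ZMod.val_cast_of_lt hi]
    · have : i = Fin.last N := Fin.ext hi
      subst this
      simpa [φ] using hp
  refine Finset.sum_le_sum_of_injOn_of_nonneg φ (fun _ _ => Finset.mem_univ _) ?_ ?_
    fun _ _ => closedWeight_nonneg hM _
  · intro p hp q hq h
    funext i
    rw [← key p (by simpa using hp), ← key q (by simpa using hq), h]
  · intro p hp
    have hp' := key p (by simpa using hp)
    rw [closedWeight_eq_prod_range, pathWeight, Finset.prod_range]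
    refine Finset.prod_congr rfl fun i _ => ?_
    have h1 := hp' i.castSucc
    have h2 := hp' i.succ
    simp only [Fin.val_castSucc, Fin.val_succ, Nat.cast_add, Nat.cast_one] at h1 h2
    rw [h1, h2]

/-- Cut a closed walk of length `2 * (m + 1)` into a step, a path of length `m + 1` and a path of
length `m`. -/
theorem sum_closedWeight_le {M : Matrix V V ℝ} (hM : ∀ a b, 0 ≤ M a b) (m : ℕ)
    (conf : V → (Fin (m + 2) → V) → Prop) [∀ a p, Decidable (conf a p)] :
    ∑ x : ZMod (2 * (m + 1)) → V with conf (x (-1)) (fun j => x (j : ℕ)), M.closedWeight x ≤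
      ∑ a, ∑ b, ∑ y, M a b * (∑ p : Fin (m + 2) → V,
        if (p 0 = b ∧ p (Fin.last _) = y) ∧ conf a p then M.pathWeight p else 0) * (M ^ m) y a := by
  have h : ∑ a, ∑ b, ∑ y, M a b * (∑ p : Fin (m + 2) → V,
        if (p 0 = b ∧ p (Fin.last _) = y) ∧ conf a p then M.pathWeight p else 0) * (M ^ m) y a =
      ∑ z : (Fin (m + 2) → V) × (Fin (m + 1) → V) with
        conf (z.2 (Fin.last _)) z.1 ∧ z.1 (Fin.last _) = z.2 0,
        M (z.2 (Fin.last _)) (z.1 0) * M.pathWeight z.1 * M.pathWeight z.2 := by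
    have h1 : ∀ a b y, M a b * (∑ p : Fin (m + 2) → V,
        if (p 0 = b ∧ p (Fin.last _) = y) ∧ conf a p then M.pathWeight p else 0) * (M ^ m) y a =
        ∑ z : (Fin (m + 2) → V) × (Fin (m + 1) → V),
          M a b * (if (z.1 0 = b ∧ z.1 (Fin.last _) = y) ∧ conf a z.1 then
            M.pathWeight z.1 else 0) *
          (if z.2 0 = y ∧ z.2 (Fin.last _) = a then M.pathWeight z.2 else 0) := by
      intro a b y
      rw [← sum_pathWeight, Finset.mul_sum _ _ (M a b), Finset.sum_mul_sum, Fintype.sum_prod_type]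
    calc _ = ∑ t : V × V × V, ∑ z : (Fin (m + 2) → V) × (Fin (m + 1) → V),
          M t.1 t.2.1 * (if (z.1 0 = t.2.1 ∧ z.1 (Fin.last _) = t.2.2) ∧ conf t.1 z.1 then
            M.pathWeight z.1 else 0) *
          (if z.2 0 = t.2.2 ∧ z.2 (Fin.last _) = t.1 then M.pathWeight z.2 else 0) := by
            simp only [Fintype.sum_prod_type (α₁ := V), h1]
      _ = _ := ?_
    rw [Finset.sum_comm, Finset.sum_filter]
    refine Finset.sum_congr rfl fun z _ => ?_
    rw [Finset.sum_eq_single (z.2 (Fin.last _), z.1 0, z.2 0)]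
    · by_cases h2 : z.1 (Fin.last _) = z.2 0 <;> by_cases h3 : conf (z.2 (Fin.last _)) z.1 <;>
        simp [h2, h3]
    · rintro ⟨a, b, y⟩ _ hne
      by_contra hcon
      apply hne
      simp only [mul_eq_zero, ite_eq_right_iff, not_or] at hcon
      grind
    · simp
  rw [h]
  -- The two pieces share the point with index `m + 1`. The second ends at index `2 * m + 1`, which
  -- is `-1`, so the remaining step closes the walk.
  let φ : (ZMod (2 * (m + 1)) → V) → (Fin (m + 2) → V) × (Fin (m + 1) → V) :=
    fun x => (fun j => x (j : ℕ), fun j => x ((m + 1 + j : ℕ)))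
  have hlast : ∀ x : ZMod (2 * (m + 1)) → V, x ((m + 1 + m : ℕ)) = x (-1) := by
    intro x
    congr 1
    rw [eq_neg_iff_add_eq_zero]
    have := ZMod.natCast_self (2 * (m + 1))
    rw [← this]
    push_cast
    ring
  refine Finset.sum_le_sum_of_injOn_of_nonneg φ ?_ ?_ ?_ fun z _ =>
    mul_nonneg (mul_nonneg (hM _ _) (pathWeight_nonneg hM _)) (pathWeight_nonneg hM _)
  · intro x hx
    have hx := (Finset.mem_filter.mp hx).2
    simp only [Finset.mem_filter, Finset.mem_univ, true_and]
    refine ⟨?_, ?_⟩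
    · simp only [φ, Fin.val_last, hlast]
      exact hx
    · simp [φ]
  · intro x _ y _ hxy
    funext i
    have h1 := congrArg Prod.fst hxy
    have h2 := congrArg Prod.snd hxy
    have hi := ZMod.val_lt i
    rcases lt_or_ge i.val (m + 2) with hlt | hge
    · simpa [φ] using congrFun h1 ⟨i.val, hlt⟩
    · have := congrFun h2 ⟨i.val - (m + 1), by lia⟩
      simp only [φ] at this
      rw [show m + 1 + (i.val - (m + 1)) = i.val by lia] at this
      simpa using this
  · intro x _
    simp only [φ]
    rw [closedWeight_eq_prod_range, pathWeight_natCast M (fun j => x (j : ℕ)),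
      pathWeight_natCast M (fun j => x ((m + 1 + j : ℕ))),
      show ∀ f : ℕ → ℝ, ∏ i ∈ range (2 * (m + 1)), f i = ∏ i ∈ range ((m + 1) + m + 1), f i from
        fun f => by rw [show 2 * (m + 1) = (m + 1) + m + 1 by ring], Finset.prod_range_succ,
      Finset.prod_range_add, Fin.val_last, hlast x, Fin.val_zero]
    have h0 : x ((m + 1 + m : ℕ) + 1) = x (0 : ℕ) := by
      congr 1
      have := ZMod.natCast_self (2 * (m + 1))
      rw [Nat.cast_zero, ← this]
      push_cast
      ring
    rw [h0]
    push_cast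
    simp only [← add_assoc]
    ring

end Matrix

/-! ### Conflict-free closed walks in a graph of large minimum degree. -/

namespace SimpleGraph

/-- From every point and in either direction, the closed walk `x` of length `2 * (m + 1)` has no
conflict between its next `m + 1` steps and the point before them. -/
def IsConflictFree {V : Type*} {m : ℕ} (conf : V → (Fin (m + 2) → V) → Prop)
    (x : ZMod (2 * (m + 1)) → V) : Prop :=
  ∀ i, ¬ conf (x (i - 1)) (fun j => x (i + (j : ℕ))) ∧ ¬ conf (x (i + 1)) (fun j => x (i - (j : ℕ)))

variable {V : Type*} [Fintype V] (G : SimpleGraph V) [DecidableRel G.Adj]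

/-- The adjacency matrix with the entry at `a, b` divided by the square root of the product of the
degrees of `a` and `b`. -/
noncomputable def normAdjMatrix : Matrix V V ℝ :=
  Matrix.of fun a b => if G.Adj a b then (√(G.degree a) * √(G.degree b))⁻¹ else 0

theorem normAdjMatrix_apply (a b : V) :
    G.normAdjMatrix a b = if G.Adj a b then (√(G.degree a) * √(G.degree b))⁻¹ else 0 := rfl

theorem normAdjMatrix_nonneg (a b : V) : 0 ≤ G.normAdjMatrix a b := by
  rw [normAdjMatrix_apply]
  split_ifs <;> positivity

theorem isSymm_normAdjMatrix : G.normAdjMatrix.IsSymm := by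
  ext a b
  simp [normAdjMatrix_apply, G.adj_comm, mul_comm]

theorem normAdjMatrix_le {δ : ℝ} (hδ : 0 < δ) (hdeg : ∀ v, δ ≤ G.degree v) (a b : V) :
    G.normAdjMatrix a b ≤ δ⁻¹ := by
  rw [normAdjMatrix_apply]
  split_ifs
  · refine inv_anti₀ hδ ?_
    calc δ = √δ * √δ := (Real.mul_self_sqrt hδ.le).symm
      _ ≤ _ := mul_le_mul (Real.sqrt_le_sqrt (hdeg a)) (Real.sqrt_le_sqrt (hdeg b))
        (Real.sqrt_nonneg _) (Real.sqrt_nonneg _)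
  · positivity

variable [DecidableEq V]

theorem normAdjMatrix_pow_nonneg (j : ℕ) (a b : V) : 0 ≤ (G.normAdjMatrix ^ j) a b := by
  rw [← Matrix.sum_pathWeight]
  refine Finset.sum_nonneg fun p _ => ?_
  split_ifs
  · exact Matrix.pathWeight_nonneg G.normAdjMatrix_nonneg p
  · rfl

/-- The vector of square roots of degrees is an eigenvector with eigenvalue 1. -/
theorem sum_normAdjMatrix_pow_mul_sqrt (hpos : ∀ v, 0 < G.degree v) (j : ℕ) (a : V) :
    ∑ b, (G.normAdjMatrix ^ j) a b * √(G.degree b) = √(G.degree a) := by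
  induction j generalizing a with
  | zero => simp [Matrix.one_apply]
  | succ j ih =>
    simp_rw [pow_succ', Matrix.mul_apply, Finset.sum_mul]
    rw [Finset.sum_comm]
    simp_rw [mul_assoc, ← Finset.mul_sum, ih]
    have h : ∀ v, √(G.degree v : ℝ) ≠ 0 := fun v =>
      (Real.sqrt_pos.mpr (by exact_mod_cast hpos v)).ne'
    have h1 : ∀ b, G.normAdjMatrix a b * √(G.degree b) =
        if G.Adj a b then (√(G.degree a))⁻¹ else 0 := by
      intro b
      rw [normAdjMatrix_apply]
      split_ifs
      · have := h b
        field_simp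
      · simp
    simp_rw [h1]
    rw [← Finset.sum_filter, Finset.sum_const, nsmul_eq_mul, ← neighborFinset_eq_filter,
      card_neighborFinset_eq_degree, ← div_eq_mul_inv, Real.div_sqrt]

/-- Evaluate the quadratic form of `M ^ j` at this eigenvector and compare with the entrywise
Cauchy–Schwarz bound. -/
theorem one_le_sqSum_normAdjMatrix [Nonempty V] (hpos : ∀ v, 0 < G.degree v) (j : ℕ) :
    1 ≤ G.normAdjMatrix.sqSum j := by
  set D : ℝ := ∑ v, (G.degree v : ℝ) with hD
  have hD0 : 0 < D := Finset.sum_pos (fun v _ => by exact_mod_cast hpos v) Finset.univ_nonempty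
  have h1 : ∑ z : V × V, (G.normAdjMatrix ^ j) z.1 z.2 * (√(G.degree z.1) * √(G.degree z.2)) =
      D := by
    rw [Fintype.sum_prod_type]
    refine Finset.sum_congr rfl fun a _ => ?_
    calc _ = √(G.degree a) * ∑ b, (G.normAdjMatrix ^ j) a b * √(G.degree b) := by
          rw [Finset.mul_sum]
          exact Finset.sum_congr rfl fun b _ => by ring
      _ = _ := by
          rw [sum_normAdjMatrix_pow_mul_sqrt G hpos, Real.mul_self_sqrt (Nat.cast_nonneg _)]
  have h2 : ∑ z : V × V, (√(G.degree z.1) * √(G.degree z.2)) ^ 2 = D * D := by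
    simp_rw [mul_pow, Real.sq_sqrt (Nat.cast_nonneg _)]
    rw [Fintype.sum_prod_type, hD, Finset.sum_mul_sum]
  have h3 := Finset.sum_mul_sq_le_sq_mul_sq Finset.univ
    (fun z : V × V => (G.normAdjMatrix ^ j) z.1 z.2) (fun z => √(G.degree z.1) * √(G.degree z.2))
  rw [h1, h2, Fintype.sum_prod_type, sq] at h3
  exact le_of_mul_le_mul_right (by rwa [one_mul]) (mul_pos hD0 hD0)

/-- For fixed `b` and `y`, let A(a) be the weight of the paths conflicting with `a`, and g the
weight of all paths. Each A(a) is at most g, and the A(a) add up to at most s g because a path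
conflicts with at most `s` neighbours of its start. So the sum of A(a)² is at most s g². -/
theorem sum_sq_conflict_le {δ : ℝ} (hδ : 0 < δ) (hdeg : ∀ v, δ ≤ G.degree v) {m s : ℕ}
    (conf : V → (Fin (m + 1) → V) → Prop) [∀ a p, Decidable (conf a p)]
    (hconf : ∀ p, #{a | G.Adj a (p 0) ∧ conf a p} ≤ s) (b y : V) :
    ∑ a, (if G.Adj a b then (∑ p : Fin (m + 1) → V,
      if (p 0 = b ∧ p (Fin.last _) = y) ∧ conf a p then G.normAdjMatrix.pathWeight p else 0)
        / √(G.degree b) else 0) ^ 2 ≤ s / δ * ((G.normAdjMatrix ^ m) b y) ^ 2 := by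
  set M := G.normAdjMatrix
  have hw := fun p : Fin (m + 1) → V => Matrix.pathWeight_nonneg G.normAdjMatrix_nonneg p
  set A : V → ℝ := fun a => ∑ p : Fin (m + 1) → V,
      if (p 0 = b ∧ p (Fin.last _) = y) ∧ conf a p then M.pathWeight p else 0 with hA
  set g := (M ^ m) b y with hg
  have hg0 : 0 ≤ g := G.normAdjMatrix_pow_nonneg m b y
  have hA0 : ∀ a, 0 ≤ A a := fun a => Finset.sum_nonneg fun p _ => by
    split_ifs
    exacts [hw p, le_rfl]
  have hAg : ∀ a, A a ≤ g := by
    intro a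
    rw [hg, ← Matrix.sum_pathWeight]
    refine Finset.sum_le_sum fun p _ => ?_
    by_cases h : p 0 = b ∧ p (Fin.last _) = y
    · by_cases h' : conf a p
      · simp [h, h']
      · simpa [h, h'] using hw p
    · simp [h]
  have hsum : ∑ a with G.Adj a b, A a ≤ s * g := by
    rw [hA, Finset.sum_comm, hg, ← Matrix.sum_pathWeight, Finset.mul_sum]
    refine Finset.sum_le_sum fun p _ => ?_
    by_cases h : p 0 = b ∧ p (Fin.last _) = y
    · simp only [h, true_and, and_self, if_true]
      rw [← Finset.sum_filter, Finset.sum_const, nsmul_eq_mul, Finset.filter_filter]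
      refine mul_le_mul_of_nonneg_right ?_ (hw p)
      have := hconf p
      rw [h.1] at this
      exact_mod_cast this
    · simp [h]
  have hterm : ∀ a, (if G.Adj a b then A a / √(G.degree b) else 0) ^ 2 ≤
      if G.Adj a b then g / δ * A a else 0 := by
    intro a
    split_ifs
    · rw [div_pow, Real.sq_sqrt (Nat.cast_nonneg _), sq, div_mul_eq_mul_div]
      exact div_le_div₀ (mul_nonneg hg0 (hA0 a)) (mul_le_mul_of_nonneg_right (hAg a) (hA0 a)) hδ
        (hdeg b)
    · simp
  calc _ ≤ ∑ a, if G.Adj a b then g / δ * A a else 0 := Finset.sum_le_sum fun a _ => hterm a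
    _ = g / δ * ∑ a with G.Adj a b, A a := by rw [← Finset.sum_filter, Finset.mul_sum]
    _ ≤ g / δ * (s * g) := mul_le_mul_of_nonneg_left hsum (by positivity)
    _ = _ := by ring

theorem sq_sum_closedWeight_conflict_le {δ : ℝ} (hδ : 0 < δ) (hdeg : ∀ v, δ ≤ G.degree v)
    {m s : ℕ} (conf : V → (Fin (m + 2) → V) → Prop) [∀ a p, Decidable (conf a p)]
    (hconf : ∀ p, #{a | G.Adj a (p 0) ∧ conf a p} ≤ s) :
    (∑ x : ZMod (2 * (m + 1)) → V with conf (x (-1)) (fun j => x (j : ℕ)),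
      G.normAdjMatrix.closedWeight x) ^ 2 ≤
      s / δ * G.normAdjMatrix.sqSum (m + 1) * G.normAdjMatrix.sqSum m := by
  set M := G.normAdjMatrix with hM
  have h0 : 0 ≤ ∑ x : ZMod (2 * (m + 1)) → V with conf (x (-1)) (fun j => x (j : ℕ)),
      M.closedWeight x :=
    Finset.sum_nonneg fun x _ => Matrix.closedWeight_nonneg G.normAdjMatrix_nonneg x
  refine (pow_le_pow_left₀ h0
    (Matrix.sum_closedWeight_le G.normAdjMatrix_nonneg m conf) 2).trans ?_
  set A : V → V → V → ℝ := fun a b y => ∑ p : Fin (m + 2) → V,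
      if (p 0 = b ∧ p (Fin.last _) = y) ∧ conf a p then M.pathWeight p else 0 with hA
  -- The entry of `M` at an edge is split between the two factors. The degree of `b` under `u`
  -- yields the gain 1/δ; the degree of `a` under `v` cancels exactly when `b` runs over the
  -- neighbours of `a`.
  let u : V × V × V → ℝ := fun t =>
    if G.Adj t.1 t.2.1 then A t.1 t.2.1 t.2.2 / √(G.degree t.2.1) else 0
  let v : V × V × V → ℝ := fun t =>
    if G.Adj t.1 t.2.1 then (M ^ m) t.2.2 t.1 / √(G.degree t.1) else 0
  have huv : ∑ a, ∑ b, ∑ y, M a b * A a b y * (M ^ m) y a = ∑ t, u t * v t := by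
    simp only [Fintype.sum_prod_type, u, v]
    refine Finset.sum_congr rfl fun a _ => Finset.sum_congr rfl fun b _ =>
      Finset.sum_congr rfl fun y _ => ?_
    rw [hM, normAdjMatrix_apply]
    split_ifs
    · rw [mul_inv]
      ring
    · simp
  have hu : ∑ t, u t ^ 2 ≤ s / δ * M.sqSum (m + 1) := by
    have : ∑ t, u t ^ 2 = ∑ b, ∑ y, ∑ a, u (a, b, y) ^ 2 := by
      rw [Fintype.sum_prod_type_right, Fintype.sum_prod_type]
    rw [this, Matrix.sqSum]
    simp_rw [Finset.mul_sum]
    exact Finset.sum_le_sum fun b _ => Finset.sum_le_sum fun y _ =>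
      G.sum_sq_conflict_le hδ hdeg conf hconf b y
  have hv : ∑ t, v t ^ 2 = M.sqSum m := by
    have : ∑ t, v t ^ 2 = ∑ y, ∑ a, ∑ b, v (a, b, y) ^ 2 := by
      simp only [Fintype.sum_prod_type]
      rw [Finset.sum_comm (γ := V) (f := fun y a => ∑ b, v (a, b, y) ^ 2)]
      exact Finset.sum_congr rfl fun a _ => Finset.sum_comm
    rw [this, Matrix.sqSum]
    refine Finset.sum_congr rfl fun y _ => Finset.sum_congr rfl fun a _ => ?_
    have hvb : ∀ b, v (a, b, y) ^ 2 =
        if G.Adj a b then (M ^ m) y a ^ 2 / G.degree a else 0 := by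
      intro b
      simp only [v]
      split_ifs
      · rw [div_pow, Real.sq_sqrt (Nat.cast_nonneg _)]
      · simp
    simp_rw [hvb]
    rw [← Finset.sum_filter, Finset.sum_const, nsmul_eq_mul, ← neighborFinset_eq_filter,
      card_neighborFinset_eq_degree, mul_div_cancel₀]
    exact (hδ.trans_le (hdeg a)).ne'
  calc _ = (∑ t, u t * v t) ^ 2 := by rw [← huv]
    _ ≤ (∑ t, u t ^ 2) * ∑ t, v t ^ 2 := Finset.sum_mul_sq_le_sq_mul_sq _ _ _
    _ ≤ _ := by
      rw [hv]
      exact mul_le_mul_of_nonneg_right hu (M.sqSum_nonneg m)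

theorem sum_closedWeight_conflict_le [Nonempty V] {δ : ℝ} (hδ : 0 < δ)
    (hdeg : ∀ v, δ ≤ G.degree v) {m s : ℕ}
    (conf : V → (Fin (m + 2) → V) → Prop) [∀ a p, Decidable (conf a p)]
    (hconf : ∀ p, #{a | G.Adj a (p 0) ∧ conf a p} ≤ s) {C : ℝ} (hC : 0 < C)
    (hcard : C ^ (m + 1) * Fintype.card V ≤ δ ^ (m + 1)) :
    (∑ x : ZMod (2 * (m + 1)) → V with conf (x (-1)) (fun j => x (j : ℕ)),
      G.normAdjMatrix.closedWeight x) ≤ √(s / C) * G.normAdjMatrix.sqSum (m + 1) := by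
  have h1 := G.sq_sum_closedWeight_conflict_le hδ hdeg conf hconf
  have hpos : ∀ v, 0 < G.degree v := fun v => by exact_mod_cast hδ.trans_le (hdeg v)
  have hH := G.one_le_sqSum_normAdjMatrix hpos (m + 1)
  set H := G.normAdjMatrix.sqSum (m + 1)
  -- As H ≥ 1, the factor H^m from log-convexity may be raised to H^(m+1), so that (m+1)-th roots
  -- can be taken.
  have h2 : G.normAdjMatrix.sqSum m ≤ δ / C * H := by
    refine le_of_pow_le_pow_left₀ (n := m + 1) (by lia) (by positivity) ?_
    calc _ ≤ Fintype.card V * H ^ m := Matrix.sqSum_pow_le G.isSymm_normAdjMatrix m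
      _ ≤ Fintype.card V * H ^ (m + 1) :=
        mul_le_mul_of_nonneg_left (pow_le_pow_right₀ hH (by lia)) (Nat.cast_nonneg _)
      _ ≤ (δ / C) ^ (m + 1) * H ^ (m + 1) := by
        refine mul_le_mul_of_nonneg_right ?_ (by positivity)
        rw [div_pow, le_div_iff₀ (by positivity), mul_comm]
        exact hcard
      _ = _ := (mul_pow _ _ _).symm
  refine abs_le_of_sq_le_sq' ?_ (by positivity) |>.2
  calc _ ≤ s / δ * H * (δ / C * H) := h1.trans (by gcongr)
    _ = s / C * H ^ 2 := by field_simp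
    _ = _ := by rw [mul_pow, Real.sq_sqrt (by positivity)]

theorem card_conflictFree_ge [Nonempty V] {δ : ℝ} (hδ : 0 < δ)
    (hdeg : ∀ v, δ ≤ G.degree v) {m s : ℕ}
    (conf : V → (Fin (m + 2) → V) → Prop)
    (hconf : ∀ p, Set.ncard {a | G.Adj a (p 0) ∧ conf a p} ≤ s) {C : ℝ} (hC : 0 < C)
    (hs : 64 * (m + 1) ^ 2 * s ≤ C)
    (hcard : C ^ (m + 1) * Fintype.card V ≤ δ ^ (m + 1)) :
    δ ^ (2 * (m + 1)) / 2 ≤ Set.ncard {x : ZMod (2 * (m + 1)) → V |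
      (∀ i, G.Adj (x i) (x (i + 1))) ∧ IsConflictFree conf x} := by
  classical
  have hconf' : ∀ p, #{a | G.Adj a (p 0) ∧ conf a p} ≤ s := fun p => by
    rw [← Set.ncard_coe_finset]
    simpa using hconf p
  set M := G.normAdjMatrix with hM
  have hB := G.sum_closedWeight_conflict_le hδ hdeg conf hconf' hC hcard
  have hpos : ∀ v, 0 < G.degree v := fun v => by exact_mod_cast hδ.trans_le (hdeg v)
  have hH := G.one_le_sqSum_normAdjMatrix hpos (m + 1)
  rw [← hM] at hB hH
  set H := M.sqSum (m + 1) with hHdef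
  have hw0 : ∀ x : ZMod (2 * (m + 1)) → V, 0 ≤ M.closedWeight x :=
    fun x => Matrix.closedWeight_nonneg G.normAdjMatrix_nonneg x
  have hsq : √(s / C) ≤ 1 / (8 * (m + 1)) := by
    refine Real.sqrt_le_iff.mpr ⟨by positivity, ?_⟩
    rw [div_pow, div_le_div_iff₀ hC (by positivity)]
    linarith
  replace hB := hB.trans (mul_le_mul_of_nonneg_right hsq (by linarith : 0 ≤ H))
  have htot : H ≤ ∑ x : ZMod (2 * (m + 1)) → V, M.closedWeight x := by
    rw [hHdef, Matrix.sqSum_eq_trace G.isSymm_normAdjMatrix]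
    exact Matrix.trace_pow_le_sum_closedWeight G.normAdjMatrix_nonneg _
  have hfwd : ∀ i : ZMod (2 * (m + 1)), ∑ x : ZMod (2 * (m + 1)) → V with
      conf (x (i - 1)) (fun j => x (i + (j : ℕ))), M.closedWeight x ≤ 1 / (8 * (m + 1)) * H := by
    intro i
    refine le_trans (Finset.sum_le_sum_of_injOn_of_nonneg (fun x j => x (i + j)) ?_ ?_ ?_
      fun x _ => hw0 x) hB
    · intro x hx
      simpa [← sub_eq_add_neg] using hx
    · intro x _ y _ hxy
      funext j
      simpa using congrFun hxy (j - i)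
    · intro x _
      rw [Matrix.closedWeight_comp_add]
  have hbwd : ∀ i : ZMod (2 * (m + 1)), ∑ x : ZMod (2 * (m + 1)) → V with
      conf (x (i + 1)) (fun j => x (i - (j : ℕ))), M.closedWeight x ≤ 1 / (8 * (m + 1)) * H := by
    intro i
    refine le_trans (Finset.sum_le_sum_of_injOn_of_nonneg (fun x j => x (i - j)) ?_ ?_ ?_
      fun x _ => hw0 x) hB
    · intro x hx
      simpa using hx
    · intro x _ y _ hxy
      funext j
      simpa using congrFun hxy (i - j)
    · intro x _
      rw [Matrix.closedWeight_comp_sub G.isSymm_normAdjMatrix]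
  have hbad : ∑ x : ZMod (2 * (m + 1)) → V with ¬ IsConflictFree conf x, M.closedWeight x ≤
      H / 2 := by
    calc _ ≤ ∑ x : ZMod (2 * (m + 1)) → V, ∑ i : ZMod (2 * (m + 1)),
          ((if conf (x (i - 1)) (fun j => x (i + (j : ℕ))) then M.closedWeight x else 0) +
            if conf (x (i + 1)) (fun j => x (i - (j : ℕ))) then M.closedWeight x else 0) := by
          rw [Finset.sum_filter]
          refine Finset.sum_le_sum fun x _ => ?_
          have hnn : ∀ i : ZMod (2 * (m + 1)), 0 ≤
            ((if conf (x (i - 1)) (fun j => x (i + (j : ℕ))) then M.closedWeight x else 0) +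
            if conf (x (i + 1)) (fun j => x (i - (j : ℕ))) then M.closedWeight x else 0) := by
            intro i
            have := hw0 x
            split_ifs <;> linarith
          by_cases h : ¬ IsConflictFree conf x
          · rw [if_pos h]
            simp only [IsConflictFree, not_forall, not_and_or, not_not] at h
            obtain ⟨i, hi⟩ := h
            refine le_trans ?_ (Finset.single_le_sum (fun i _ => hnn i) (Finset.mem_univ i))
            have := hw0 x
            rcases hi with hi | hi <;> rw [if_pos hi] <;> split_ifs <;> linarith
          · rw [if_neg h]
            exact Finset.sum_nonneg fun i _ => hnn i
      _ = ∑ i : ZMod (2 * (m + 1)), (∑ x : ZMod (2 * (m + 1)) → V with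
            conf (x (i - 1)) (fun j => x (i + (j : ℕ))), M.closedWeight x +
          ∑ x : ZMod (2 * (m + 1)) → V with
            conf (x (i + 1)) (fun j => x (i - (j : ℕ))), M.closedWeight x) := by
          rw [Finset.sum_comm]
          simp_rw [Finset.sum_add_distrib, Finset.sum_filter]
      -- There are 2(m+1) positions and two directions, hence 4(m+1) terms; the constant 64 in `hs`
      -- was chosen to make each at most H/(8(m+1)).
      _ ≤ ∑ i : ZMod (2 * (m + 1)), (1 / (8 * (m + 1)) * H + 1 / (8 * (m + 1)) * H) :=
          Finset.sum_le_sum fun i _ => add_le_add (hfwd i) (hbwd i)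
      _ = H / 2 := by
          rw [Finset.sum_const, Finset.card_univ, ZMod.card, nsmul_eq_mul]
          push_cast
          field_simp
          ring
  have hgood : H / 2 ≤ ∑ x : ZMod (2 * (m + 1)) → V with IsConflictFree conf x,
      M.closedWeight x := by
    have := Finset.sum_filter_add_sum_filter_not (Finset.univ : Finset (ZMod (2 * (m + 1)) → V))
      (fun x => IsConflictFree conf x) (fun x => M.closedWeight x)
    linarith
  have hcount : ∑ x : ZMod (2 * (m + 1)) → V with IsConflictFree conf x, M.closedWeight x ≤
      Set.ncard {x : ZMod (2 * (m + 1)) → V |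
        (∀ i, G.Adj (x i) (x (i + 1))) ∧ IsConflictFree conf x} * (δ⁻¹) ^ (2 * (m + 1)) := by
    have hset : {x : ZMod (2 * (m + 1)) → V |
        (∀ i, G.Adj (x i) (x (i + 1))) ∧ IsConflictFree conf x} =
        ((({x | (∀ i, G.Adj (x i) (x (i + 1))) ∧ IsConflictFree conf x} :
          Finset (ZMod (2 * (m + 1)) → V))) : Set (ZMod (2 * (m + 1)) → V)) := by simp
    rw [hset, Set.ncard_coe_finset, ← nsmul_eq_mul, ← Finset.sum_const, Finset.sum_filter,
      Finset.sum_filter]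
    refine Finset.sum_le_sum fun x _ => ?_
    by_cases hx : IsConflictFree conf x
    · by_cases hadj : ∀ i, G.Adj (x i) (x (i + 1))
      · simp only [hx, hadj, implies_true, and_self, if_true]
        calc M.closedWeight x ≤ ∏ _i : ZMod (2 * (m + 1)), δ⁻¹ :=
              Finset.prod_le_prod (fun _ _ => G.normAdjMatrix_nonneg _ _)
                fun _ _ => G.normAdjMatrix_le hδ hdeg _ _
          _ = _ := by simp
      · rw [if_pos hx, if_neg (fun h => hadj h.1)]
        push Not at hadj
        obtain ⟨i, hi⟩ := hadj
        refine (Finset.prod_eq_zero (Finset.mem_univ i) ?_).le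
        rw [hM, normAdjMatrix_apply, if_neg hi]
    · simp [hx]
  have hfin := hgood.trans hcount
  rw [inv_pow, ← div_eq_mul_inv, le_div_iff₀ (by positivity)] at hfin
  refine le_trans ?_ hfin
  have : 0 < δ ^ (2 * (m + 1)) := by positivity
  nlinarith

end SimpleGraph

/-! ### From conflict-free walks to linear cycles in partial linear spaces. -/

namespace PartialLinearSpace

variable {V ι : Type*}

/-- Any two distinct points lie on at most one common line. -/
def IsLinear (inc : V → ι → Prop) : Prop :=
  ∀ a b, a ≠ b → ∀ e f, inc a e → inc b e → inc a f → inc b f → e = f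

/-- Two points are adjacent if they are distinct and lie on a common line. -/
def collinearityGraph (inc : V → ι → Prop) : SimpleGraph V where
  Adj a b := a ≠ b ∧ ∃ e, inc a e ∧ inc b e
  symm := ⟨fun _ _ h => ⟨h.1.symm, h.2.imp fun _ he => he.symm⟩⟩
  loopless := ⟨fun _ h => h.1 rfl⟩

/-- The line of one of the steps of `p` contains `a`, or it avoids the start of `p` but meets a line
through `a` and the start of `p`. -/
def Conflict (inc : V → ι → Prop) {m : ℕ} (a : V) (p : Fin (m + 2) → V) : Prop :=
  ∃ (j : Fin (m + 1)) (f : ι), p j.castSucc ≠ p j.succ ∧ inc (p j.castSucc) f ∧ inc (p j.succ) f ∧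
    (inc a f ∨ ¬ inc (p 0) f ∧ ∃ e z, inc a e ∧ inc (p 0) e ∧ inc z e ∧ inc z f)

theorem ncard_conflict_le [Finite V] {inc : V → ι → Prop} (hlin : IsLinear inc) {r : ℕ}
    (hr : ∀ e, Set.ncard {v | inc v e} ≤ r) {m : ℕ} (p : Fin (m + 2) → V) :
    Set.ncard {a | (collinearityGraph inc).Adj a (p 0) ∧ Conflict inc a p} ≤
      (m + 1) * (r + r * r) := by
  classical
  have := Fintype.ofFinite V
  have hr' : ∀ e, #{v | inc v e} ≤ r := fun e => by
    rw [← Set.ncard_coe_finset]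
    simpa using hr e
  let S : Fin (m + 1) → Finset V := fun j =>
    {a | ∃ f : ι, p j.castSucc ≠ p j.succ ∧ inc (p j.castSucc) f ∧ inc (p j.succ) f ∧
      (inc a f ∨ ¬ inc (p 0) f ∧ ∃ e z, inc a e ∧ inc (p 0) e ∧ inc z e ∧ inc z f)}
  have hline : ∀ b z, b ≠ z → #{a | ∃ e, inc a e ∧ inc b e ∧ inc z e} ≤ r := by
    intro b z hbz
    by_cases h : ∃ e, inc b e ∧ inc z e
    · obtain ⟨e, hbe, hze⟩ := h
      refine (Finset.card_le_card ?_).trans (hr' e)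
      intro a ha
      obtain ⟨e', hae, hbe', hze'⟩ := (Finset.mem_filter.mp ha).2
      have : e' = e := hlin b z hbz _ _ hbe' hze' hbe hze
      simpa [this] using hae
    · rw [Finset.card_eq_zero.mpr]
      · exact Nat.zero_le _
      · refine Finset.filter_eq_empty_iff.mpr fun a _ ha => h ?_
        exact ha.imp fun e he => he.2
  have hS : ∀ j, #(S j) ≤ r + r * r := by
    intro j
    by_cases h : ∃ f : ι, p j.castSucc ≠ p j.succ ∧ inc (p j.castSucc) f ∧ inc (p j.succ) f
    · obtain ⟨f, hne, h1, h2⟩ := h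
      have hsub : S j ⊆ ({v | inc v f} : Finset V) ∪
          ({z | inc z f ∧ p 0 ≠ z} : Finset V).biUnion
            fun z => {a | ∃ e, inc a e ∧ inc (p 0) e ∧ inc z e} := by
        intro a ha
        obtain ⟨f', _, h1', h2', h3⟩ := (Finset.mem_filter.mp ha).2
        have : f' = f := hlin _ _ hne _ _ h1' h2' h1 h2
        subst this
        rcases h3 with h3 | ⟨h0, e, z, hae, h0e, hze, hzf⟩
        · exact Finset.mem_union_left _ (by simpa using h3)
        · refine Finset.mem_union_right _ (Finset.mem_biUnion.mpr ⟨z, ?_, ?_⟩)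
          · simp only [Finset.mem_filter, Finset.mem_univ, true_and]
            exact ⟨hzf, fun h => h0 (h ▸ hzf)⟩
          · simp only [Finset.mem_filter, Finset.mem_univ, true_and]
            exact ⟨e, hae, h0e, hze⟩
      refine (Finset.card_le_card hsub).trans ((Finset.card_union_le _ _).trans
        (add_le_add (hr' f) ((Finset.card_biUnion_le_card_mul _ _ r ?_).trans ?_)))
      · intro z hz
        exact hline _ _ (Finset.mem_filter.mp hz).2.2
      · refine Nat.mul_le_mul_right r ((Finset.card_le_card ?_).trans (hr' f))
        exact Finset.monotone_filter_right _ fun z _ hz => hz.1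
    · rw [Finset.card_eq_zero.mpr]
      · exact Nat.zero_le _
      · refine Finset.filter_eq_empty_iff.mpr fun a _ ha => h ?_
        exact ha.imp fun f hf => ⟨hf.1, hf.2.1, hf.2.2.1⟩
  calc _ ≤ Set.ncard ((Finset.univ.biUnion S : Finset V) : Set V) := by
        refine Set.ncard_le_ncard ?_ (Finset.finite_toSet _)
        rintro a ⟨_, j, f, h⟩
        simp only [Finset.coe_biUnion, Set.mem_iUnion]
        exact ⟨j, by simp, Finset.mem_filter.mpr ⟨Finset.mem_univ _, f, h⟩⟩
    _ ≤ _ := by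
        rw [Set.ncard_coe_finset]
        refine (Finset.card_biUnion_le_card_mul _ _ _ fun j _ => hS j).trans ?_
        simp

/-- Consecutive points of `x` are distinct and on the common line `e i`, and two of these lines
meet only if they are consecutive, and then only in the common point of `x`. -/
def IsLinearCycle (inc : V → ι → Prop) {N : ℕ} (x : ZMod N → V) (e : ZMod N → ι) : Prop :=
  (∀ i, x i ≠ x (i + 1) ∧ inc (x i) (e i) ∧ inc (x (i + 1)) (e i)) ∧
    ∀ i j z, inc z (e i) → inc z (e j) →
      i = j ∨ (j = i + 1 ∧ z = x j) ∨ (i = j + 1 ∧ z = x i)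

theorem natCast_ne_zero_of_lt {N t : ℕ} (h0 : 0 < t) (ht : t < N) : (t : ZMod N) ≠ 0 := by
  rw [Ne, ZMod.natCast_eq_zero_iff]
  exact Nat.not_dvd_of_pos_of_lt h0 ht

/-- The first alternative of a conflict keeps points of the walk off the lines of other steps
(`hmem`). This supplies the avoidance condition needed for the second alternative, which keeps
non-consecutive lines disjoint (`hmeet`). Looking m + 1 steps ahead suffices, since any two
positions are that close in one of the two directions. -/
theorem exists_isLinearCycle {inc : V → ι → Prop} (hlin : IsLinear inc) {m : ℕ} (hm : 1 ≤ m)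
    {x : ZMod (2 * (m + 1)) → V} (hadj : ∀ i, (collinearityGraph inc).Adj (x i) (x (i + 1)))
    (hfree : SimpleGraph.IsConflictFree (Conflict inc) x) : ∃ e, IsLinearCycle inc x e := by
  choose hne e he1 he2 using hadj
  refine ⟨e, fun i => ⟨hne i, he1 i, he2 i⟩, ?_⟩
  have hN : ((2 * (m + 1) : ℕ) : ZMod (2 * (m + 1))) = 0 := ZMod.natCast_self _
  have hsplit : ∀ i j : ZMod (2 * (m + 1)), ∃ t : ℕ, t < 2 * (m + 1) ∧ j = i + t := fun i j =>
    ⟨(j - i).val, ZMod.val_lt _, by simp⟩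
  have hmem : ∀ i j, inc (x i) (e j) → i = j ∨ i = j + 1 := by
    intro i j hij
    obtain ⟨t, ht, rfl⟩ := hsplit i j
    rcases Nat.eq_zero_or_pos t with rfl | ht0
    · simp
    rcases lt_or_ge t (m + 2) with htm | htm
    · exfalso
      refine (hfree (i + 1)).1 ⟨⟨t - 1, by lia⟩, e (i + t), ?_⟩
      obtain ⟨u, rfl⟩ := Nat.exists_eq_add_of_le' ht0
      have h1 : i + 1 + (u : ZMod (2 * (m + 1))) = i + ((u + 1 : ℕ) : ZMod (2 * (m + 1))) := by
        push_cast
        ring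
      have h2 : i + 1 + ((u + 1 : ℕ) : ZMod (2 * (m + 1))) =
          i + ((u + 1 : ℕ) : ZMod (2 * (m + 1))) + 1 := by ring
      simp only [Fin.castSucc_mk, Fin.succ_mk, Nat.add_sub_cancel, h1, h2]
      refine ⟨hne _, he1 _, he2 _, Or.inl ?_⟩
      simpa using hij
    -- Beyond the forward window the step is seen backwards from `i`; the last value, t = 2m + 1, is
    -- the line entering `x i` and is allowed.
    rcases (Nat.lt_succ_iff.mp (show t < (2 * m + 1) + 1 by lia)).lt_or_eq with ht' | rfl
    · exfalso
      refine (hfree (i - 1)).2 ⟨⟨2 * m - t, by lia⟩, e (i + t), ?_⟩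
      have hc : ((2 * m - t : ℕ) : ZMod (2 * (m + 1))) = - (t : ZMod (2 * (m + 1))) - 2 := by
        rw [Nat.cast_sub (by lia)]
        push_cast at hN ⊢
        linear_combination hN
      have h1 : i - 1 - ((2 * m - t : ℕ) : ZMod (2 * (m + 1))) = i + t + 1 := by
        rw [hc]
        ring
      have h2 : i - 1 - ((2 * m - t + 1 : ℕ) : ZMod (2 * (m + 1))) = i + t := by
        rw [Nat.cast_add, hc]
        push_cast
        ring
      simp only [Fin.castSucc_mk, Fin.succ_mk, h1, h2]
      refine ⟨(hne _).symm, he2 _, he1 _, Or.inl ?_⟩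
      simpa using hij
    · right
      push_cast at hN ⊢
      linear_combination -hN
  have hmeet : ∀ i z, ∀ t : ℕ, 0 < t → t < m + 2 → inc z (e i) → inc z (e (i + t)) →
      i + (t : ZMod (2 * (m + 1))) = i + 1 ∧ z = x (i + t) := by
    intro i z t ht0 htm hz1 hz2
    obtain ⟨u, rfl⟩ := Nat.exists_eq_add_of_le' ht0
    rcases Nat.eq_zero_or_pos u with rfl | hu
    · simp only [zero_add, Nat.cast_one, true_and] at hz2 ⊢
      by_contra hzx
      have hee : e i = e (i + 1) := hlin _ _ hzx _ _ hz1 (he2 i) hz2 (he1 _)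
      have := hmem i (i + 1) (hee ▸ he1 i)
      have h1 := natCast_ne_zero_of_lt (N := 2 * (m + 1)) one_pos (by lia)
      have h2 := natCast_ne_zero_of_lt (N := 2 * (m + 1)) two_pos (by lia)
      rcases this with h | h
      · exact h1 (by push_cast; linear_combination -h)
      · exact h2 (by push_cast; linear_combination -h)
    · exfalso
      have hnot : ¬ inc (x (i + 1)) (e (i + (u + 1 : ℕ))) := by
        intro h
        rcases hmem _ _ h with h | h
        · exact natCast_ne_zero_of_lt (N := 2 * (m + 1)) hu (by lia)
            (by push_cast at h; linear_combination -h)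
        · exact natCast_ne_zero_of_lt (N := 2 * (m + 1)) (Nat.succ_pos u) (by lia)
            (by push_cast at h ⊢; linear_combination -h)
      refine (hfree (i + 1)).1 ⟨⟨u, by lia⟩, e (i + (u + 1 : ℕ)), ?_⟩
      have h1 : i + 1 + (u : ZMod (2 * (m + 1))) = i + ((u + 1 : ℕ) : ZMod (2 * (m + 1))) := by
        push_cast
        ring
      have h2 : i + 1 + ((u + 1 : ℕ) : ZMod (2 * (m + 1))) =
          i + ((u + 1 : ℕ) : ZMod (2 * (m + 1))) + 1 := by ring
      simp only [Fin.castSucc_mk, Fin.succ_mk, h1, h2]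
      refine ⟨hne _, he1 _, he2 _, Or.inr ⟨by simpa using hnot, e i, z, ?_, ?_, hz1, hz2⟩⟩
      · simpa using he1 i
      · simpa using he2 i
  intro i j z hzi hzj
  obtain ⟨t, ht, rfl⟩ := hsplit i j
  rcases Nat.eq_zero_or_pos t with rfl | ht0
  · simp
  rcases lt_or_ge t (m + 2) with htm | htm
  · exact Or.inr (Or.inl (hmeet i z t ht0 htm hzi hzj))
  · have hi : i = i + t + ((2 * (m + 1) - t : ℕ) : ZMod (2 * (m + 1))) := by
      rw [Nat.cast_sub ht.le, hN]
      ring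
    have := hmeet (i + t) z (2 * (m + 1) - t) (by lia) (by lia) hzj (by rwa [← hi])
    rw [← hi] at this
    exact Or.inr (Or.inr this)

/-- Choosing a second point on each line through `v` is injective by linearity. -/
theorem le_degree_collinearityGraph [Fintype V] {inc : V → ι → Prop} (hlin : IsLinear inc)
    [DecidableRel (collinearityGraph inc).Adj]
    (h2 : ∀ v e, inc v e → ∃ w, w ≠ v ∧ inc w e) (v : V) :
    Set.ncard {e | inc v e} ≤ (collinearityGraph inc).degree v := by
  classical
  choose! w hw1 hw2 using h2
  rw [← SimpleGraph.card_neighborFinset_eq_degree, ← Set.ncard_coe_finset]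
  refine Set.ncard_le_ncard_of_injOn (w v) ?_ ?_ (Finset.finite_toSet _)
  · intro e he
    simp only [SimpleGraph.coe_neighborFinset, SimpleGraph.mem_neighborSet]
    exact ⟨(hw1 v e he).symm, e, he, hw2 v e he⟩
  · intro e he f hf hef
    exact hlin v (w v e) (hw1 v e he).symm e f he (hw2 v e he) hf (hef ▸ hw2 v f hf)

theorem ncard_linearCycle_ge [Finite V] [Nonempty V] {inc : V → ι → Prop} (hlin : IsLinear inc)
    {r : ℕ} (hr : ∀ e, Set.ncard {v | inc v e} ≤ r)
    (h2 : ∀ v e, inc v e → ∃ w, w ≠ v ∧ inc w e) {δ : ℝ} (hδ : 0 < δ)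
    (hdeg : ∀ v, δ ≤ Set.ncard {e | inc v e}) {m : ℕ} (hm : 1 ≤ m) {C : ℝ} (hC : 0 < C)
    (hs : 64 * (m + 1) ^ 2 * ((m + 1) * (r + r * r)) ≤ C)
    (hcard : C ^ (m + 1) * Nat.card V ≤ δ ^ (m + 1)) :
    δ ^ (2 * (m + 1)) / 2 ≤
      Set.ncard {x : ZMod (2 * (m + 1)) → V | ∃ e, IsLinearCycle inc x e} := by
  classical
  have := Fintype.ofFinite V
  rw [Nat.card_eq_fintype_card] at hcard
  refine ((collinearityGraph inc).card_conflictFree_ge hδ (fun v => (hdeg v).trans ?_)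
    (Conflict inc) (ncard_conflict_le hlin hr) hC (by exact_mod_cast hs) hcard).trans ?_
  · exact_mod_cast le_degree_collinearityGraph hlin h2 v
  · refine Nat.cast_le.mpr (Set.ncard_le_ncard ?_ (Set.toFinite _))
    rintro x ⟨hadj, hfree⟩
    exact exists_isLinearCycle hlin hm hadj hfree

end PartialLinearSpace

/-! ### Reduction to large minimum degree, and copies of the linear cycle. -/

namespace Hypergraph

variable {α : Type*}

theorem finite_edgeSet {G : Hypergraph α} (hV : V(G).Finite) : E(G).Finite :=
  hV.finite_subsets.subset fun _ he => G.subset_vertexSet_of_mem_edgeSet' he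

theorem finite_copies {β : Type*} (H : Hypergraph β) {G : Hypergraph α} (hV : V(G).Finite) :
    (copies H G).Finite := by
  refine Set.Finite.of_finite_image (f := fun K : Hypergraph α => (V(K), E(K))) ?_ ?_
  · refine (hV.finite_subsets.prod (finite_edgeSet hV).finite_subsets).subset ?_
    rintro _ ⟨K, hK, rfl⟩
    exact ⟨hK.1, hK.2.1⟩
  · intro K _ L _ h
    exact Hypergraph.ext (congrArg Prod.fst h) (congrArg Prod.snd h)

/-- A hypergraph with `δ * n ≤ e` has an induced subhypergraph of minimum degree at least `δ`. -/
theorem exists_subset_minDegree_ge {G : Hypergraph α} (hV : V(G).Finite) (hVne : V(G).Nonempty)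
    (hE : ∅ ∉ E(G)) {δ : ℝ} (hδ : 0 < δ) (hδE : δ * V(G).ncard ≤ E(G).ncard) :
    ∃ S ⊆ V(G), S.Nonempty ∧ ∀ v ∈ S, δ ≤ Set.ncard {e ∈ E(G) | e ⊆ S ∧ v ∈ e} := by
  classical
  have hfin : ∀ P : Set α → Prop, {e ∈ E(G) | P e}.Finite := fun P =>
    (finite_edgeSet hV).subset fun _ he => he.1
  let F : Set (Set α) :=
    {S | S ⊆ V(G) ∧ S.Nonempty ∧ δ * S.ncard ≤ Set.ncard {e ∈ E(G) | e ⊆ S}}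
  have hF : F.Finite := hV.finite_subsets.subset fun S hS => hS.1
  have hVF : V(G) ∈ F := by
    refine ⟨subset_rfl, hVne, ?_⟩
    have : {e ∈ E(G) | e ⊆ V(G)} = E(G) :=
      Set.sep_eq_self_iff_mem_true.mpr fun e he => G.subset_vertexSet_of_mem_edgeSet' he
    rwa [this]
  -- In a smallest set of density at least δ no vertex has degree below δ: deleting it would leave a
  -- smaller such set. The density then becomes strictly larger than δ, which also rules out the
  -- empty set.
  obtain ⟨S, ⟨hSV, hSne, hS⟩, hmin⟩ := hF.exists_minimalFor Set.ncard F ⟨_, hVF⟩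
  refine ⟨S, hSV, hSne, fun v hv => ?_⟩
  by_contra! hlt
  have hSfin := hV.subset hSV
  have hcard : ((S \ {v}).ncard : ℝ) + 1 = S.ncard := by
    exact_mod_cast Set.ncard_sdiff_singleton_add_one hv hSfin
  have hsplit : Set.ncard {e ∈ E(G) | e ⊆ S} =
      Set.ncard {e ∈ E(G) | e ⊆ S \ {v}} + Set.ncard {e ∈ E(G) | e ⊆ S ∧ v ∈ e} := by
    rw [← Set.ncard_union_eq ?_ (hfin _) (hfin _)]
    · congr 1
      ext e
      simp only [Set.mem_ofPred_eq, Set.mem_union, Set.subset_sdiff, Set.disjoint_singleton_right]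
      tauto
    · rw [Set.disjoint_left]
      rintro e ⟨_, h⟩ ⟨_, _, hve⟩
      exact (h hve).2 rfl
  have hbig : δ * (S \ {v}).ncard < Set.ncard {e ∈ E(G) | e ⊆ S \ {v}} := by
    rw [hsplit] at hS
    push_cast at hS
    nlinarith
  have hne : (S \ {v}).Nonempty := by
    rw [Set.nonempty_iff_ne_empty]
    intro h0
    rw [h0] at hbig
    have : {e ∈ E(G) | e ⊆ (∅ : Set α)} = ∅ := by
      refine Set.eq_empty_of_forall_notMem fun e he => hE ?_
      rw [← Set.subset_empty_iff.mp he.2]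
      exact he.1
    rw [this] at hbig
    simp at hbig
  have hmem : S \ {v} ∈ F := ⟨Set.sdiff_subset.trans hSV, hne, hbig.le⟩
  have h1 : (S.ncard : ℝ) ≤ (S \ {v}).ncard := by
    by_contra! h
    exact h.not_ge (Nat.cast_le.mpr (hmin hmem (Nat.cast_le.mp h.le)))
  linarith

theorem natCast_cyclicSucc {N : ℕ} (i : Fin N) :
    ((cyclicSucc i : Fin N) : ZMod N) = (i : ℕ) + 1 := by
  simp [cyclicSucc]

theorem natCast_fin_injective {N : ℕ} {i j : Fin N}
    (h : ((i : ℕ) : ZMod N) = ((j : ℕ) : ZMod N)) : i = j := by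
  have := congrArg ZMod.val h
  rwa [ZMod.val_cast_of_lt i.2, ZMod.val_cast_of_lt j.2, Fin.val_inj] at this

/-- A cyclic sequence of edges that meet only in the prescribed points is a copy of the linear
cycle through these points. -/
theorem exists_copy_linearCycle {G : Hypergraph α} {r : ℕ} (hr : 2 ≤ r)
    (hunif : G.IsUniform r) {N : ℕ} (hN : 3 ≤ N) {x : ZMod N → α} {e : ZMod N → Set α}
    (he : ∀ i, e i ∈ E(G)) (hx : PartialLinearSpace.IsLinearCycle (fun v f => v ∈ f) x e) :
    ∃ K ∈ copies (linearCycle r N) G, (∀ i, x i ∈ V(K)) ∧ V(K).ncard ≤ N * r := by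
  obtain ⟨hstep, hmeet⟩ := hx
  have : NeZero N := ⟨by lia⟩
  have hmem : ∀ i j, x i ∈ e j → i = j ∨ i = j + 1 := by
    intro i j hij
    rcases hmeet i j (x i) (hstep i).2.1 hij with h | ⟨h, h'⟩ | ⟨h, _⟩
    · exact Or.inl h
    · exact absurd (h ▸ h') (hstep i).1
    · exact Or.inr h
  have hrest : ∀ i, Nat.card (e i \ {x i, x (i + 1)} : Set α) = r - 2 := by
    intro i
    have h1 : (e i).ncard = r := by
      rw [Set.ncard, hunif _ (he i)]
      simp
    have h2 : ({x i, x (i + 1)} : Set α) ⊆ e i :=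
      Set.insert_subset (hstep i).2.1 (Set.singleton_subset_iff.mpr (hstep i).2.2)
    rw [Nat.card_coe_set_eq, Set.ncard_sdiff h2, h1, Set.ncard_pair (hstep i).1]
  have hfinite : ∀ i, Finite (e i \ {x i, x (i + 1)} : Set α) := fun i =>
    ((Set.finite_of_encard_eq_coe (hunif _ (he i))).subset Set.sdiff_subset).to_subtype
  let g : (i : ZMod N) → Fin (r - 2) ≃ (e i \ {x i, x (i + 1)} : Set α) := fun i =>
    (Finite.equivFinOfCardEq (hrest i)).symm
  let f : Fin N ⊕ Fin N × Fin (r - 2) → α :=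
    Sum.elim (fun i => x (i : ℕ)) (fun z => (g (z.1 : ℕ) z.2 : α))
  have hgm : ∀ i l, ((g i l : α)) ∈ e i := fun i l => (g i l).2.1
  have hg1 : ∀ i l, ((g i l : α)) ≠ x i := fun i l h => (g i l).2.2 (Or.inl h)
  have hg2 : ∀ i l, ((g i l : α)) ≠ x (i + 1) := fun i l h => (g i l).2.2 (Or.inr h)
  have htwo : (2 : ZMod N) ≠ 0 := by
    exact_mod_cast PartialLinearSpace.natCast_ne_zero_of_lt (N := N) two_pos (by lia)
  have hxinj : ∀ i j, x i = x j → i = j := by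
    intro i j hij
    rcases hmem i j (hij ▸ (hstep j).2.1) with h | h
    · exact h
    · exact absurd (by rw [← h, hij]) (hstep j).1
  have hxg : ∀ i j l, x i ≠ g j l := by
    intro i j l h
    rcases hmem i j (h ▸ hgm j l) with rfl | rfl
    · exact hg1 _ _ h.symm
    · exact hg2 _ _ h.symm
  have hf : Function.Injective f := by
    rintro (i | ⟨i, l⟩) (j | ⟨j, l'⟩) h
    · rw [natCast_fin_injective (hxinj _ _ h)]
    · exact absurd h (hxg _ _ _)
    · exact absurd h.symm (hxg _ _ _)
    · have h : (g (i : ℕ) l : α) = g (j : ℕ) l' := h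
      rcases hmeet _ _ _ (hgm _ l) (h ▸ hgm _ l') with hij | ⟨_, hij⟩ | ⟨_, hij⟩
      · obtain rfl := natCast_fin_injective hij
        rw [(g _).injective (Subtype.ext h)]
      · exact absurd (h ▸ hij) (hg1 _ _)
      · exact absurd hij (hg1 _ _)
  have hedge : ∀ i : Fin N, f '' ({Sum.inl i, Sum.inl (cyclicSucc i)} ∪
      Set.range fun j : Fin (r - 2) => Sum.inr (i, j)) = e (i : ℕ) := by
    intro i
    rw [Set.image_union, Set.image_pair, ← Set.range_comp]
    have hr1 : Set.range (f ∘ fun j : Fin (r - 2) => Sum.inr (i, j)) =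
        e (i : ℕ) \ {x (i : ℕ), x ((i : ℕ) + 1)} := by
      ext v
      constructor
      · rintro ⟨l, rfl⟩
        exact (g _ l).2
      · intro hv
        exact ⟨(g _).symm ⟨v, hv⟩, by simp [f]⟩
    rw [hr1]
    simp only [f, Sum.elim_inl, natCast_cyclicSucc]
    refine Set.union_sdiff_cancel ?_
    exact Set.insert_subset (hstep _).2.1 (Set.singleton_subset_iff.mpr (hstep _).2.2)
  have hE : E((linearCycle r N).image f) ⊆ E(G) := by
    rintro _ ⟨_, ⟨i, rfl⟩, rfl⟩
    rw [hedge]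
    exact he _
  refine ⟨(linearCycle r N).image f, ⟨?_, hE, f, hf.injOn, rfl⟩, ?_, ?_⟩
  · rintro _ ⟨v, _, rfl⟩
    rcases v with i | ⟨i, l⟩
    · exact G.subset_vertexSet_of_mem_edgeSet' (he _) (hstep (i : ℕ)).2.1
    · exact G.subset_vertexSet_of_mem_edgeSet' (he _) (hgm (i : ℕ) l)
  · intro i
    exact ⟨Sum.inl ⟨i.val, ZMod.val_lt i⟩, Set.mem_univ _, by simp [f]⟩
  · refine (Set.ncard_image_le (Set.toFinite _)).trans ?_
    have : (V(linearCycle r N)).ncard = N + N * (r - 2) := by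
      change (Set.univ : Set (Fin N ⊕ Fin N × Fin (r - 2))).ncard = _
      rw [Set.ncard_univ, Nat.card_eq_fintype_card]
      simp
    rw [this]
    obtain ⟨q, rfl⟩ := Nat.exists_eq_add_of_le hr
    simp only [Nat.add_sub_cancel_left]
    nlinarith

/-- A sequence assigned to a copy K takes all its N values among the at most N r vertices of K. -/
theorem ncard_linearCycle_le_mul_numCopies {G : Hypergraph α} (hV : V(G).Finite) {r : ℕ}
    (hr : 2 ≤ r) (hunif : G.IsUniform r) {N : ℕ} (hN : 3 ≤ N) :
    Set.ncard {x : ZMod N → α | ∃ e : ZMod N → Set α, (∀ i, e i ∈ E(G)) ∧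
      PartialLinearSpace.IsLinearCycle (fun v f => v ∈ f) x e} ≤
      (N * r) ^ N * (linearCycle r N).numCopies G := by
  classical
  have : NeZero N := ⟨by lia⟩
  set X := {x : ZMod N → α | ∃ e : ZMod N → Set α, (∀ i, e i ∈ E(G)) ∧
      PartialLinearSpace.IsLinearCycle (fun v f => v ∈ f) x e}
  have hex : ∀ x ∈ X, ∃ K ∈ copies (linearCycle r N) G,
      (∀ i, x i ∈ V(K)) ∧ V(K).ncard ≤ N * r := by
    rintro x ⟨e, he, hx⟩
    exact exists_copy_linearCycle hr hunif hN he hx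
  choose! κ hκ1 hκ2 hκ3 using hex
  have hcop := finite_copies (linearCycle r N) hV
  have hX : X.Finite := by
    refine (Set.Finite.pi' (fun _ : ZMod N => hV)).subset fun x hx i => ?_
    exact (hκ1 x hx).1 (hκ2 x hx i)
  rw [numCopies, Set.ncard_eq_toFinset_card _ hX, Set.ncard_eq_toFinset_card _ hcop]
  refine Finset.card_le_mul_card_image_of_maps_to (f := κ) ?_ _ ?_
  · intro x hx
    rw [Set.Finite.mem_toFinset] at hx ⊢
    exact hκ1 x hx
  · intro K hK
    rw [Set.Finite.mem_toFinset] at hK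
    have hKfin := hV.subset hK.1
    by_cases hne : ∃ x ∈ X, κ x = K
    · obtain ⟨x₀, hx₀, rfl⟩ := hne
      calc _ ≤ #(Fintype.piFinset fun _ : ZMod N => hKfin.toFinset) := by
            refine Finset.card_le_card fun x hx => ?_
            rw [Finset.mem_filter, Set.Finite.mem_toFinset] at hx
            rw [Fintype.mem_piFinset]
            intro i
            rw [Set.Finite.mem_toFinset, ← hx.2]
            exact hκ2 x hx.1 i
        _ = V(κ x₀).ncard ^ N := by
            rw [Fintype.card_piFinset, Finset.prod_const, Finset.card_univ, ZMod.card,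
              Set.ncard_eq_toFinset_card _ hKfin]
        _ ≤ _ := Nat.pow_le_pow_left (hκ3 x₀ hx₀) _
    · rw [Finset.card_eq_zero.mpr]
      · exact Nat.zero_le _
      · refine Finset.filter_eq_empty_iff.mpr fun x hx h => hne ⟨x, ?_, h⟩
        simpa using hx

theorem numCopies_linearCycle_ge {G : Hypergraph α} (hV : V(G).Finite) (hVne : V(G).Nonempty)
    {r : ℕ} (hr : 2 ≤ r) (hunif : G.IsUniform r) (hlin : G.IsLinear) {m : ℕ} (hm : 1 ≤ m)
    {δ : ℝ} (hδ : 0 < δ) (hδE : δ * V(G).ncard ≤ E(G).ncard) {C : ℝ} (hC : 0 < C)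
    (hs : 64 * (m + 1) ^ 2 * ((m + 1) * (r + r * r)) ≤ C)
    (hcard : C ^ (m + 1) * V(G).ncard ≤ δ ^ (m + 1)) :
    δ ^ (2 * (m + 1)) / 2 ≤
      (2 * (m + 1) * r : ℝ) ^ (2 * (m + 1)) * (linearCycle r (2 * (m + 1))).numCopies G := by
  classical
  have hncard : ∀ e ∈ E(G), e.ncard = r := fun e he => by
    rw [Set.ncard, hunif _ he]
    simp
  have hefin : ∀ e ∈ E(G), e.Finite := fun e he => Set.finite_of_encard_eq_coe (hunif _ he)
  have hempty : ∅ ∉ E(G) := fun h => by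
    have := hncard _ h
    simp at this
    lia
  obtain ⟨S, hSV, hSne, hSdeg⟩ := exists_subset_minDegree_ge hV hVne hempty hδ hδE
  have hSfin := hV.subset hSV
  have : Finite S := hSfin.to_subtype
  have : Nonempty S := hSne.to_subtype
  -- Only edges inside `S` serve as lines, so each keeps all its r points and intersections in `G`
  -- are already seen in `S`.
  let inc : S → {e : Set α // e ∈ E(G) ∧ e ⊆ S} → Prop := fun v e => (v : α) ∈ (e : Set α)
  have hinc : PartialLinearSpace.IsLinear inc := by
    intro a b hab e f hae hbe haf hbf
    by_contra hef
    exact hab (Subtype.ext (hlin e e.2.1 f f.2.1 (fun h => hef (Subtype.ext h))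
      ⟨hae, haf⟩ ⟨hbe, hbf⟩))
  have hline : ∀ e, Set.ncard {v | inc v e} ≤ r := by
    intro e
    rw [← hncard e e.2.1]
    exact Set.ncard_le_ncard_of_injOn Subtype.val (fun v hv => hv)
      Subtype.val_injective.injOn (hefin e e.2.1)
  have htwo : ∀ v e, inc v e → ∃ w, w ≠ v ∧ inc w e := by
    intro v e hve
    obtain ⟨w, hw, hwv⟩ := Set.exists_ne_of_one_lt_ncard
      (show 1 < (e : Set α).ncard by rw [hncard e e.2.1]; lia) v
    exact ⟨⟨w, e.2.2 hw⟩, fun h => hwv (congrArg Subtype.val h), hw⟩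
  have hdeg : ∀ v, δ ≤ Set.ncard {e | inc v e} := by
    intro v
    refine (hSdeg v v.2).trans (Nat.cast_le.mpr ?_)
    have himg : {e ∈ E(G) | e ⊆ S ∧ (v : α) ∈ e} = Subtype.val '' {e | inc v e} := by
      ext e
      constructor
      · rintro ⟨h1, h2, h3⟩
        exact ⟨⟨e, h1, h2⟩, h3, rfl⟩
      · rintro ⟨e, h, rfl⟩
        exact ⟨e.2.1, e.2.2, h⟩
    rw [himg, Set.ncard_image_of_injective _ Subtype.val_injective]
  have hcardS : C ^ (m + 1) * Nat.card S ≤ δ ^ (m + 1) := by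
    refine le_trans ?_ hcard
    rw [Nat.card_coe_set_eq]
    gcongr
  refine (PartialLinearSpace.ncard_linearCycle_ge hinc hline htwo hδ hdeg hm hC hs hcardS).trans ?_
  have hle := ncard_linearCycle_le_mul_numCopies hV hr hunif (N := 2 * (m + 1)) (by lia)
  refine le_trans (Nat.cast_le.mpr ?_)
    (((Nat.cast_le (α := ℝ)).mpr hle).trans_eq (by push_cast; ring))
  refine Set.ncard_le_ncard_of_injOn (fun x i => (x i : α)) ?_ ?_ ?_
  · rintro x ⟨e, hstep, hmeet⟩
    refine ⟨fun i => e i, fun i => (e i).2.1, fun i => ⟨fun h => (hstep i).1 (Subtype.ext h),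
      (hstep i).2⟩, fun i j z hzi hzj => ?_⟩
    have := hmeet i j ⟨z, (e i).2.2 hzi⟩ hzi hzj
    simpa only [Subtype.ext_iff] using this
  · intro x _ y _ hxy
    funext i
    exact Subtype.ext (congrFun hxy i)
  · refine (Set.Finite.pi' (fun _ : ZMod (2 * (m + 1)) => hV)).subset ?_
    rintro x ⟨e, he, hx⟩ i
    exact G.subset_vertexSet_of_mem_edgeSet' (he i) (hx.1 i).2.1

end Hypergraph

theorem theorem1p2 (k r : ℕ) (hk : 2 ≤ k) (hr : 2 ≤ r) :
    ∃ C c : ℝ, 0 < C ∧ 0 < c ∧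
      ∀ (α : Type*) (G : Hypergraph α) (n : ℕ),
        V(G).Finite → V(G).ncard = n → G.IsUniform r → G.IsLinear →
        C * (n : ℝ) ^ (1 + 1 / (k : ℝ)) ≤ (E(G).ncard : ℝ) →
        c * ((E(G).ncard : ℝ) / (n : ℝ)) ^ (2 * k) ≤
          ((Hypergraph.linearCycle r (2 * k)).numCopies G : ℝ) := by
  obtain ⟨m, rfl⟩ := Nat.exists_eq_add_of_le' (show 1 ≤ k by lia)
  have hr0 : (0 : ℝ) < r := by exact_mod_cast (by lia : 0 < r)
  refine ⟨64 * (m + 1) ^ 2 * ((m + 1) * (r + r * r)),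
    (2 * (2 * (m + 1) * r : ℝ) ^ (2 * (m + 1)))⁻¹, by positivity, by positivity, ?_⟩
  rintro α G n hV rfl hunif hlin hE
  set C : ℝ := 64 * (m + 1) ^ 2 * ((m + 1) * (r + r * r)) with hCdef
  have hC : 0 < C := by positivity
  rcases V(G).eq_empty_or_nonempty with h0 | hne
  -- With no vertices the quotient is a division by zero, so the lower bound is 0.
  · rw [h0]
    simp
  have hn : (0 : ℝ) < V(G).ncard := by
    exact_mod_cast (Set.ncard_pos hV).mpr hne
  set n : ℝ := (V(G).ncard : ℝ) with hndef
  have hδ1 : C * n ^ (1 / ((m + 1 : ℕ) : ℝ)) ≤ E(G).ncard / n := by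
    rw [le_div_iff₀ hn]
    rw [Real.rpow_add hn, Real.rpow_one] at hE
    linarith
  have hcard : C ^ (m + 1) * n ≤ (E(G).ncard / n) ^ (m + 1) := by
    calc C ^ (m + 1) * n = (C * n ^ (1 / ((m + 1 : ℕ) : ℝ))) ^ (m + 1) := by
          rw [mul_pow C, one_div, Real.rpow_inv_natCast_pow hn.le (by lia)]
      _ ≤ _ := pow_le_pow_left₀ (by positivity) hδ1 _
  have hδ : 0 < E(G).ncard / n := lt_of_lt_of_le (by positivity) hδ1
  have := Hypergraph.numCopies_linearCycle_ge hV hne hr hunif hlin (by lia : 1 ≤ m) hδ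
    (div_mul_cancel₀ _ hn.ne').le hC hCdef.ge hcard
  rw [inv_mul_le_iff₀ (by positivity)]
  linarith
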